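/- An *iterated function system* (IFS) on $\mathbb R$ is a finite set $\{S_i\}_{i=1}^m$ of distinct contracting similarities, $|S_i(x)-S_i(y)|=r_i|x-y|$ for all $x,y\in\mathbb R$ with $0<r_i<1$ (the contraction ratio of $S_i$); $m$ is its cardinality. It is a *generating IFS* of a nonempty compact set $K$, and $K$ is its *attractor*, if $K=\bigcup_{i=1}^m S_i(K)$. It satisfies the *strong separation condition* (SSC) if this union is disjoint. A nonempty compact set $K\subset\mathbb R$ is *full-measure* if $\mathcal H^{s}(K)=\operatorname{diam}(K)^{s}$, where $s=\dim_H K$ and $\mathcal H^s$ is the Hausdorff measure normalized as $\lim_{\delta\to0}\inf\{\sum_i\operatorname{diam}(U_i)^s : K\subset\bigcup_i U_i,\ \operatorname{diam}U_i\le\delta\}$ (with $0^0=1$). For $\delta>0$, two points of $K$ are $\delta$-equivalent if they are joined by a finite chain of points of $K$ with consecutive distances at most $\delta$; let $\kappa(\delta)$ be the (finite) number of $\delta$-equivalence classes. The *gap length set* $\mathrm{GL}(K)$ is the set of points of discontinuity of $\kappa$ on $(0,\operatorname{diam}K)$. For $\Theta\subset(0,\infty)$ and $\theta\in\Theta$ put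 $$R_\Theta(\theta)=\{r\in(0,1):\ \text{there is }\theta'\in\Theta\text{ with }\theta\in\{\theta' r^k\}_{k=0}^\infty\subset\Theta\}.$$ **Corollary.** Let $K\subset\mathbb R$ be a full-measure set that is the attractor of an IFS $\Phi$ satisfying the SSC. Then every generating IFS of $K$ (with or without any separation condition) has cardinality at least $$\dim_{\mathbb Q}\operatorname{span}_{\mathbb Q}\Big\{\log r:\ r\in\bigcup_{\theta\in \mathrm{GL}(K)}R_{\mathrm{GL}(K)}(\theta)\Big\}.$$ If, further, the logarithms of the contraction ratios of the similarities in $\Phi$ are distinct from each other and linearly independent over $\mathbb Q$, then $\Phi$ has the minimal cardinality among all generating IFSs of $K$. -/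

import Mathlib

open MeasureTheory

/-- A finite family of pairwise distinct contracting similarities of a metric space, with their
contraction ratios (for metric spaces with at least two points the ratios are determined by the
maps). -/
structure SimilarityIFS (M : Type*) [MetricSpace M] where
  /-- the cardinality of the system -/
  card : ℕ
  map : Fin card → M → M
  map_injective : Function.Injective map
  ratio : Fin card → ℝ
  ratio_pos : ∀ i, 0 < ratio i
  ratio_lt_one : ∀ i, ratio i < 1
  dist_map : ∀ i x y, dist (map i x) (map i y) = ratio i * dist x y

/-- `Φ` is a generating IFS of `K`: the set `K` is the attractor of `Φ`, that is, a nonempty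
compact set which is the union of its images under the maps of `Φ`. -/
def SimilarityIFS.Generates {M : Type*} [MetricSpace M] (Φ : SimilarityIFS M) (K : Set M) :
    Prop :=
  K.Nonempty ∧ IsCompact K ∧ K = ⋃ i, Φ.map i '' K

/-- The strong separation condition for an IFS `Φ` with attractor `K`. -/
def SimilarityIFS.StrongSeparation {M : Type*} [MetricSpace M] (Φ : SimilarityIFS M)
    (K : Set M) : Prop :=
  ∀ i j, i ≠ j → Disjoint (Φ.map i '' K) (Φ.map j '' K)

/-- Two points of `K` are `δ`-equivalent if they are joined by a finite chain of points of `K`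
whose consecutive distances are at most `δ`. -/
def chainSetoid {M : Type*} [MetricSpace M] (K : Set M) (δ : ℝ) : Setoid K where
  r := Relation.ReflTransGen fun x y : K => dist x y ≤ δ
  iseqv :=
    { refl := fun _ => Relation.ReflTransGen.refl
      symm := by
        intro x y h
        induction h with
        | refl => exact Relation.ReflTransGen.refl
        | tail _ hbc ih => exact Relation.ReflTransGen.head (by rwa [dist_comm]) ih
      trans := fun h₁ h₂ => Relation.ReflTransGen.trans h₁ h₂ }

/-- The number of `δ`-equivalence classes of `K`; it is finite for compact `K` and `δ > 0`. -/
noncomputable def chainClassCount {M : Type*} [MetricSpace M] (K : Set M) (δ : ℝ) : ℕ :=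
  Nat.card (Quotient (chainSetoid K δ))

/-- The gap length set of `K`: the points of discontinuity of the function counting
`δ`-equivalence classes on the interval `0 < δ < diam K`. -/
noncomputable def gapLengthSet {M : Type*} [MetricSpace M] (K : Set M) : Set ℝ :=
  {δ | δ ∈ Set.Ioo 0 (Metric.diam K) ∧
    ¬ ContinuousWithinAt (fun t : ℝ => (chainClassCount K t : ℝ))
      (Set.Ioo 0 (Metric.diam K)) δ}

/-- The common ratios of the (infinite) strictly decreasing geometric sequences in `Θ` that
contain `θ`. -/
def geometricRatios (Θ : Set ℝ) (θ : ℝ) : Set ℝ :=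
  {r | r ∈ Set.Ioo (0 : ℝ) 1 ∧
    ∃ θ' ∈ Θ, (∃ k : ℕ, θ = θ' * r ^ k) ∧ ∀ k : ℕ, θ' * r ^ k ∈ Θ}

/-- The rational vector space spanned by the logarithms of all common ratios of strictly
decreasing geometric sequences in the gap length set of `K`. -/
noncomputable def gapLogSpan {M : Type*} [MetricSpace M] (K : Set M) : Submodule ℚ ℝ :=
  Submodule.span ℚ
    (Real.log '' ⋃ θ ∈ gapLengthSet K, geometricRatios (gapLengthSet K) θ)

/-- A nonempty compact set `K ⊆ ℝ` is full-measure if its Hausdorff measure in its Hausdorff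
dimension `s` equals `(diam K) ^ s` (with `0 ^ 0 = 1`). -/
def IsFullMeasure (K : Set ℝ) : Prop :=
  K.Nonempty ∧ IsCompact K ∧
    Measure.hausdorffMeasure (dimH K).toReal K = Metric.ediam K ^ (dimH K).toReal

open scoped ENNReal Topology

/-! Write `s` for the dimension of `K`. Under the SSC, refining a cover by the maps of `Φ` preserves
the sum of `s`-th powers of diameters, so the measure of `K` equals its content and no measurable
`U` carries more than `diam U ^ s` of it. If `K` is full-measure, a copy `f '' K ⊆ K` already
carries this maximum for its convex hull, so the hull contains no other point of `K`
(`IsFullMeasure.inter_Icc_subset_image`). This holds for every similar copy inside `K`, which is why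
the competing IFS `Ψ` needs no separation.

Gap lengths are lengths of bounded complementary intervals (`mem_gapLengthSet_iff`). Since the
copies under `Ψ` are order-convex in `K`, every gap either starts at the maximum of a copy, giving
finitely many lengths, or is a scaled gap. Hence log gap lengths lie in finitely many cosets of the
span of the log ratios of `Ψ`. Two terms of a geometric sequence share a coset, so the log of its
common ratio is in that span. Conversely each map of `Φ` sends gaps to gaps, so its ratios occur as
common ratios, and linear independence makes the bound reach `Φ.card`. -/

/-- The map `f` multiplies all distances by `r`. -/
def ScalesDist (f : ℝ → ℝ) (r : ℝ) : Prop :=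
  ∀ x y, dist (f x) (f y) = r * dist x y

namespace ScalesDist

variable {f : ℝ → ℝ} {r : ℝ}

theorem injective (hf : ScalesDist f r) (hr : 0 < r) : Function.Injective f := by
  intro x y h
  have h1 := hf x y
  rw [h, dist_self, eq_comm, mul_eq_zero] at h1
  exact dist_eq_zero.1 (h1.resolve_left hr.ne')

theorem lipschitzWith (hf : ScalesDist f r) (hr : 0 < r) : LipschitzWith r.toNNReal f :=
  LipschitzWith.of_dist_le_mul fun x y => by rw [hf x y, Real.coe_toNNReal r hr.le]

theorem antilipschitzWith (hf : ScalesDist f r) (hr : 0 < r) :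
    AntilipschitzWith r⁻¹.toNNReal f :=
  AntilipschitzWith.of_le_mul_dist fun x y => by
    rw [hf x y, Real.coe_toNNReal _ (inv_pos.2 hr).le, inv_mul_cancel_left₀ hr.ne']

theorem continuous (hf : ScalesDist f r) (hr : 0 < r) : Continuous f :=
  (hf.lipschitzWith hr).continuous

theorem ediam_image_le (hf : ScalesDist f r) (hr : 0 < r) (A : Set ℝ) :
    Metric.ediam (f '' A) ≤ ENNReal.ofReal r * Metric.ediam A :=
  (hf.lipschitzWith hr).ediam_image_le A

theorem hausdorffMeasure_image (hf : ScalesDist f r) (hr : 0 < r) {s : ℝ} (hs : 0 ≤ s)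
    (A : Set ℝ) :
    Measure.hausdorffMeasure s (f '' A) =
      ENNReal.ofReal r ^ s * Measure.hausdorffMeasure s A := by
  refine le_antisymm ((hf.lipschitzWith hr).hausdorffMeasure_image_le hs A) ?_
  have h := (hf.antilipschitzWith hr).le_hausdorffMeasure_image hs A
  calc ENNReal.ofReal r ^ s * Measure.hausdorffMeasure s A
      ≤ ENNReal.ofReal r ^ s *
          (ENNReal.ofReal r⁻¹ ^ s * Measure.hausdorffMeasure s (f '' A)) := by
        gcongr; exact h
    _ = Measure.hausdorffMeasure s (f '' A) := by
        rw [← mul_assoc, ← ENNReal.mul_rpow_of_nonneg _ _ hs, ← ENNReal.ofReal_mul hr.le,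
          mul_inv_cancel₀ hr.ne', ENNReal.ofReal_one, ENNReal.one_rpow, one_mul]

theorem comp {g : ℝ → ℝ} {q : ℝ} (hf : ScalesDist f r) (hg : ScalesDist g q) :
    ScalesDist (f ∘ g) (r * q) := fun x y => by
  rw [Function.comp, Function.comp, hf, hg, mul_assoc]

end ScalesDist

/-! ### Hausdorff measure and content of a self-similar set -/

namespace SimilarityIFS

variable {Φ : SimilarityIFS ℝ} {K : Set ℝ}

theorem scalesDist (Φ : SimilarityIFS ℝ) (i : Fin Φ.card) : ScalesDist (Φ.map i) (Φ.ratio i) :=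
  Φ.dist_map i

theorem Generates.image_subset (h : Φ.Generates K) (i : Fin Φ.card) : Φ.map i '' K ⊆ K := by
  intro x hx
  rw [h.2.2]
  exact Set.mem_iUnion.2 ⟨i, hx⟩

theorem Generates.exists_mem_image (h : Φ.Generates K) {x : ℝ} (hx : x ∈ K) :
    ∃ i, x ∈ Φ.map i '' K := by
  rw [h.2.2] at hx
  exact Set.mem_iUnion.1 hx

theorem exists_ratio_le (Φ : SimilarityIFS ℝ) :
    ∃ ρ : ℝ, 0 < ρ ∧ ρ < 1 ∧ ∀ i, Φ.ratio i ≤ ρ := by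
  obtain h | h := isEmpty_or_nonempty (Fin Φ.card)
  · exact ⟨1 / 2, by norm_num, by norm_num, fun i => h.elim i⟩
  · obtain ⟨i, hi⟩ := Finite.exists_max Φ.ratio
    exact ⟨Φ.ratio i, Φ.ratio_pos i, Φ.ratio_lt_one i, hi⟩

theorem Generates.isCompact_image (h : Φ.Generates K) (i : Fin Φ.card) :
    IsCompact (Φ.map i '' K) :=
  h.2.1.image ((Φ.scalesDist i).continuous (Φ.ratio_pos i))

theorem Generates.sum_ratio_rpow (h : Φ.Generates K) (hsep : Φ.StrongSeparation K) {s : ℝ}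
    (hs : 0 ≤ s) (h0 : Measure.hausdorffMeasure s K ≠ 0)
    (htop : Measure.hausdorffMeasure s K ≠ ⊤) :
    ∑ i, ENNReal.ofReal (Φ.ratio i) ^ s = 1 := by
  have h1 : Measure.hausdorffMeasure s (⋃ i, Φ.map i '' K) =
      ∑ i, ENNReal.ofReal (Φ.ratio i) ^ s * Measure.hausdorffMeasure s K := by
    rw [measure_iUnion (fun i j hij => hsep i j hij)
      (fun i => (h.isCompact_image i).measurableSet), tsum_fintype]
    exact Finset.sum_congr rfl fun i _ =>
      (Φ.scalesDist i).hausdorffMeasure_image (Φ.ratio_pos i) hs K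
  rw [← h.2.2, ← Finset.sum_mul] at h1
  exact (ENNReal.mul_left_inj h0 htop).1 (by rw [one_mul, ← h1])

/-- Replacing a cover by its images under all maps covers `K` again, multiplies the sum by at most
`∑ rᵢ ^ s = 1`, and shrinks diameters by `ρ`. -/
theorem Generates.exists_fine_cover (h : Φ.Generates K) {s : ℝ} (hs : 0 ≤ s)
    (hsum : ∑ i, ENNReal.ofReal (Φ.ratio i) ^ s = 1) {ρ : ℝ} (hρ : ∀ i, Φ.ratio i ≤ ρ)
    {E : ℕ → Set ℝ} (hE : K ⊆ ⋃ k, E k) (n : ℕ) :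
    ∃ (ι : Type) (_ : Countable ι) (F : ι → Set ℝ), K ⊆ ⋃ k, F k ∧
      (∀ k, Metric.ediam (F k) ≤ ENNReal.ofReal ρ ^ n * Metric.ediam K) ∧
      ∑' k, Metric.ediam (F k) ^ s ≤ ∑' k, Metric.ediam (E k) ^ s := by
  induction n with
  | zero =>
    -- Intersecting with `K` bounds the initial diameters.
    refine ⟨ℕ, inferInstance, fun k => E k ∩ K, fun x hx => ?_, fun k => ?_, ?_⟩
    · obtain ⟨k, hk⟩ := Set.mem_iUnion.1 (hE hx)
      exact Set.mem_iUnion.2 ⟨k, hk, hx⟩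
    · rw [pow_zero, one_mul]
      exact Metric.ediam_mono Set.inter_subset_right
    · gcongr with k
      exact Set.inter_subset_left
  | succ n ih =>
    obtain ⟨ι, hι, F, hF, hd, hle⟩ := ih
    refine ⟨Fin Φ.card × ι, inferInstance, fun p => Φ.map p.1 '' F p.2, fun x hx => ?_,
      fun p => ?_, ?_⟩
    · obtain ⟨i, y, hy, rfl⟩ := h.exists_mem_image hx
      obtain ⟨k, hk⟩ := Set.mem_iUnion.1 (hF hy)
      exact Set.mem_iUnion.2 ⟨(i, k), y, hk, rfl⟩
    · refine ((Φ.scalesDist p.1).ediam_image_le (Φ.ratio_pos p.1) _).trans ?_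
      rw [pow_succ', mul_assoc]
      exact mul_le_mul' (ENNReal.ofReal_le_ofReal (hρ p.1)) (hd p.2)
    · calc ∑' p : Fin Φ.card × ι, Metric.ediam (Φ.map p.1 '' F p.2) ^ s
          ≤ ∑' p : Fin Φ.card × ι,
              ENNReal.ofReal (Φ.ratio p.1) ^ s * Metric.ediam (F p.2) ^ s := by
            refine ENNReal.tsum_le_tsum fun p => ?_
            rw [← ENNReal.mul_rpow_of_nonneg _ _ hs]
            exact ENNReal.rpow_le_rpow
              ((Φ.scalesDist p.1).ediam_image_le (Φ.ratio_pos p.1) _) hs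
        _ = ∑' k, Metric.ediam (F k) ^ s := by
            rw [ENNReal.tsum_prod', tsum_fintype]
            simp only [ENNReal.tsum_mul_left]
            rw [← Finset.sum_mul, hsum, one_mul]
        _ ≤ _ := hle

/-- The Hausdorff measure of a self-similar set agrees with its Hausdorff content. -/
theorem Generates.hausdorffMeasure_le_tsum (h : Φ.Generates K) {s : ℝ} (hs : 0 ≤ s)
    (hsum : ∑ i, ENNReal.ofReal (Φ.ratio i) ^ s = 1)
    {E : ℕ → Set ℝ} (hE : K ⊆ ⋃ k, E k) :
    Measure.hausdorffMeasure s K ≤ ∑' k, Metric.ediam (E k) ^ s := by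
  obtain ⟨ρ, -, hρ1, hρ⟩ := Φ.exists_ratio_le
  choose ι hι F hF hd hle using h.exists_fine_cover hs hsum hρ hE
  have hlim : Filter.Tendsto (fun n : ℕ => ENNReal.ofReal ρ ^ n * Metric.ediam K)
      Filter.atTop (𝓝 0) := by
    have h1 := ENNReal.Tendsto.mul_const (b := Metric.ediam K)
      (ENNReal.tendsto_pow_atTop_nhds_zero_of_lt_one
      (r := ENNReal.ofReal ρ) (by rwa [ENNReal.ofReal_lt_one]))
      (Or.inr h.2.1.isBounded.ediam_ne_top)
    rwa [zero_mul] at h1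
  refine (Measure.hausdorffMeasure_le_liminf_tsum s K _ hlim F
    (Filter.Eventually.of_forall hd) (Filter.Eventually.of_forall hF)).trans ?_
  exact Filter.liminf_le_of_frequently_le' (Filter.Frequently.of_forall hle)

/-- Add `U` to a nearly optimal cover of `K \ U`, compare with the content bound, and cancel the
finite measure of `K \ U`. -/
theorem Generates.hausdorffMeasure_inter_le (h : Φ.Generates K) {s : ℝ} (hs : 0 < s)
    (hsum : ∑ i, ENNReal.ofReal (Φ.ratio i) ^ s = 1)
    (htop : Measure.hausdorffMeasure s K ≠ ⊤) {U : Set ℝ} (hU : MeasurableSet U) :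
    Measure.hausdorffMeasure s (K ∩ U) ≤ Metric.ediam U ^ s := by
  have hfin : Measure.hausdorffMeasure s (K \ U) ≠ ⊤ :=
    measure_ne_top_of_subset Set.sdiff_subset htop
  refine le_of_forall_pos_le_add fun ε hε => ?_
  have hlt : Measure.hausdorffMeasure s (K \ U) < Measure.hausdorffMeasure s (K \ U) + ε :=
    ENNReal.lt_add_right hfin hε.ne'
  nth_rewrite 1 [Measure.hausdorffMeasure_apply] at hlt
  have h1 := (le_iSup₂ (f := fun (r : ℝ≥0∞) (_ : 0 < r) =>
    ⨅ (t : ℕ → Set ℝ) (_ : K \ U ⊆ ⋃ n, t n) (_ : ∀ n, Metric.ediam (t n) ≤ r),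
          ∑' n, ⨆ _ : (t n).Nonempty, Metric.ediam (t n) ^ s) 1 one_pos).trans_lt hlt
  simp only [iInf_lt_iff] at h1
  obtain ⟨t, ht, -, hsumt⟩ := h1
  have hsup : ∀ n, ⨆ _ : (t n).Nonempty, Metric.ediam (t n) ^ s = Metric.ediam (t n) ^ s := by
    intro n
    obtain hn | hn := (t n).eq_empty_or_nonempty
    · simp [hn, hs]
    · simp [hn]
  simp only [hsup] at hsumt
  let E : ℕ → Set ℝ := fun n => Nat.casesOn n U t
  have hE : K ⊆ ⋃ n, E n := by
    intro x hx
    by_cases hxU : x ∈ U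
    · exact Set.mem_iUnion.2 ⟨0, hxU⟩
    · obtain ⟨n, hn⟩ := Set.mem_iUnion.1 (ht ⟨hx, hxU⟩)
      exact Set.mem_iUnion.2 ⟨n + 1, hn⟩
  have h2 := h.hausdorffMeasure_le_tsum hs.le hsum hE
  rw [tsum_eq_zero_add' ENNReal.summable, ← measure_inter_add_sdiff K hU] at h2
  have h3 : Measure.hausdorffMeasure s (K ∩ U) + Measure.hausdorffMeasure s (K \ U) ≤
      (Metric.ediam U ^ s + ε) + Measure.hausdorffMeasure s (K \ U) := by
    refine h2.trans ?_
    rw [add_assoc, add_comm ε]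
    exact add_le_add_right hsumt.le _
  exact (ENNReal.add_le_add_iff_right hfin).1 h3

theorem Generates.exists_small_copy (h : Φ.Generates K) {ρ : ℝ} (hρ : ∀ i, Φ.ratio i ≤ ρ)
    (n : ℕ) {x : ℝ} (hx : x ∈ K) :
    ∃ f r, ScalesDist f r ∧ 0 < r ∧ r ≤ ρ ^ n ∧ f '' K ⊆ K ∧ x ∈ f '' K := by
  induction n generalizing x with
  | zero => exact ⟨id, 1, fun x y => by simp, one_pos, by simp, by simp, by simpa⟩
  | succ n ih =>
    obtain ⟨i, y, hy, rfl⟩ := h.exists_mem_image hx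
    obtain ⟨f, r, hf, hr, hrn, hfK, hyf⟩ := ih hy
    refine ⟨Φ.map i ∘ f, Φ.ratio i * r, (Φ.scalesDist i).comp hf, mul_pos (Φ.ratio_pos i) hr, ?_,
      ?_, ?_⟩
    · rw [pow_succ']
      exact mul_le_mul (hρ i) hrn hr.le ((Φ.ratio_pos i).le.trans (hρ i))
    · rw [Set.image_comp]
      exact (Set.image_mono hfK).trans (h.image_subset i)
    · rw [Set.image_comp]
      exact Set.mem_image_of_mem _ hyf

theorem Generates.hausdorffMeasure_inter_pos (h : Φ.Generates K) {s : ℝ} (hs : 0 ≤ s)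
    (h0 : Measure.hausdorffMeasure s K ≠ 0) {O : Set ℝ} (hO : IsOpen O) {x : ℝ} (hx : x ∈ K)
    (hxO : x ∈ O) : 0 < Measure.hausdorffMeasure s (K ∩ O) := by
  obtain ⟨ρ, hρ0, hρ1, hρ⟩ := Φ.exists_ratio_le
  obtain ⟨ε, hε, hball⟩ := Metric.isOpen_iff.1 hO x hxO
  have hlim : Filter.Tendsto (fun n : ℕ => ρ ^ n * Metric.diam K) Filter.atTop (𝓝 0) := by
    simpa using (tendsto_pow_atTop_nhds_zero_of_lt_one hρ0.le hρ1).mul_const (Metric.diam K)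
  obtain ⟨n, hn⟩ := (hlim.eventually (gt_mem_nhds hε)).exists
  obtain ⟨f, r, hf, hr, hrn, hfK, y, hy, rfl⟩ := h.exists_small_copy hρ n hx
  have hsub : f '' K ⊆ K ∩ O := by
    refine Set.subset_inter hfK ?_
    rintro _ ⟨z, hz, rfl⟩
    refine hball ?_
    rw [Metric.mem_ball, hf]
    refine lt_of_le_of_lt ?_ hn
    exact mul_le_mul hrn (Metric.dist_le_diam_of_mem h.2.1.isBounded hz hy) dist_nonneg
      (pow_nonneg hρ0.le n)
  refine lt_of_lt_of_le ?_ (measure_mono hsub)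
  rw [hf.hausdorffMeasure_image hr hs]
  exact ENNReal.mul_pos (ENNReal.rpow_pos (ENNReal.ofReal_pos.2 hr) ENNReal.ofReal_ne_top).ne' h0

theorem Generates.diam_eq_zero_of_subsingleton_index (h : Φ.Generates K)
    (hsub : Subsingleton (Fin Φ.card)) : Metric.diam K = 0 := by
  obtain ⟨x, hx⟩ := h.1
  obtain ⟨i, -⟩ := h.exists_mem_image hx
  have hle : Metric.diam K ≤ Φ.ratio i * Metric.diam K := by
    refine Metric.diam_le_of_forall_dist_le
      (mul_nonneg (Φ.ratio_pos i).le Metric.diam_nonneg) fun x hx y hy => ?_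
    obtain ⟨j, a, ha, rfl⟩ := h.exists_mem_image hx
    obtain ⟨k, b, hb, rfl⟩ := h.exists_mem_image hy
    rw [Subsingleton.elim j i, Subsingleton.elim k i, Φ.dist_map]
    exact mul_le_mul_of_nonneg_left (Metric.dist_le_diam_of_mem h.2.1.isBounded ha hb)
      (Φ.ratio_pos i).le
  have h1 := Φ.ratio_lt_one i
  have h2 : 0 ≤ Metric.diam K := Metric.diam_nonneg
  nlinarith

end SimilarityIFS

/-! ### Order-convexity of similar copies -/

/-- A similar copy of a strongly separated full-measure set inside the set is cut out by an
interval. -/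
theorem IsFullMeasure.inter_Icc_subset_image {K : Set ℝ} (hK : IsFullMeasure K)
    {Φ : SimilarityIFS ℝ} (hΦ : Φ.Generates K) (hsep : Φ.StrongSeparation K)
    {f : ℝ → ℝ} {r : ℝ} (hf : ScalesDist f r) (hr : 0 < r) (hfK : f '' K ⊆ K)
    {c d : ℝ} (hc : IsLeast (f '' K) c) (hd : IsGreatest (f '' K) d) :
    K ∩ Set.Icc c d ⊆ f '' K := by
  obtain ⟨hne, hcpt, hmeas⟩ := hK
  obtain hdiam | hdiam := (Metric.diam_nonneg (s := K)).eq_or_lt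
  · rintro x ⟨hx, -⟩
    have h1 := Metric.dist_le_diam_of_mem hcpt.isBounded hx (hfK hc.1)
    rw [← hdiam] at h1
    rw [dist_le_zero.1 h1]
    exact hc.1
  set s := (dimH K).toReal
  have hs0 : 0 ≤ s := ENNReal.toReal_nonneg
  have hed0 : Metric.ediam K ≠ 0 := fun h => by simp [Metric.diam, h] at hdiam
  have hedtop : Metric.ediam K ≠ ⊤ := hcpt.isBounded.ediam_ne_top
  have h0 : Measure.hausdorffMeasure s K ≠ 0 := by
    rw [hmeas]
    exact (ENNReal.rpow_pos hed0.bot_lt hedtop).ne'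
  have htop : Measure.hausdorffMeasure s K ≠ ⊤ := by
    rw [hmeas]
    exact ENNReal.rpow_ne_top_of_nonneg hs0 hedtop
  have hsum := hΦ.sum_ratio_rpow hsep hs0 h0 htop
  -- For `s = 0` the sum of `rᵢ ^ s` counts the maps, so there is only one and `K` is a point.
  have hs : 0 < s := by
    refine hs0.lt_of_ne fun hs => hdiam.ne' ?_
    rw [← hs] at hsum
    have hcard : Φ.card = 1 := by simpa using hsum
    exact hΦ.diam_eq_zero_of_subsingleton_index (by rw [hcard]; infer_instance)
  have hcl : IsClosed (f '' K) := (hcpt.image (hf.continuous hr)).isClosed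
  have hsub : f '' K ⊆ K ∩ Set.Icc c d := fun x hx => ⟨hfK hx, hc.2 hx, hd.2 hx⟩
  have hlen : Metric.ediam (Set.Icc c d) ≤ ENNReal.ofReal r * Metric.ediam K := by
    obtain ⟨u, hu, hcu⟩ := hc.1
    obtain ⟨v, hv, hdv⟩ := hd.1
    rw [Real.ediam_Icc]
    calc ENNReal.ofReal (d - c) ≤ ENNReal.ofReal (r * dist v u) := by
          rw [← hf, hcu, hdv, Real.dist_eq]
          exact ENNReal.ofReal_le_ofReal (le_abs_self _)
      _ = ENNReal.ofReal r * edist v u := by rw [ENNReal.ofReal_mul hr.le, edist_dist]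
      _ ≤ _ := by gcongr; exact Metric.edist_le_ediam_of_mem hv hu
  -- Full measure enters here: the bound `(r * diam K) ^ s` is exactly the measure of `f '' K`.
  have hle : Measure.hausdorffMeasure s (K ∩ Set.Icc c d) ≤
      Measure.hausdorffMeasure s (f '' K) := by
    refine (hΦ.hausdorffMeasure_inter_le hs hsum htop measurableSet_Icc).trans ?_
    rw [hf.hausdorffMeasure_image hr hs0, hmeas, ← ENNReal.mul_rpow_of_nonneg _ _ hs0]
    exact ENNReal.rpow_le_rpow hlen hs0
  intro x hx
  by_contra hxf
  have hxc : c < x := lt_of_le_of_ne hx.2.1 fun h => hxf (h ▸ hc.1)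
  have hxd : x < d := lt_of_le_of_ne hx.2.2 fun h => hxf (h ▸ hd.1)
  -- A stray point has a neighbourhood in the hull missing the copy, whose positive mass exceeds the
  -- bound.
  have hpos := hΦ.hausdorffMeasure_inter_pos hs0 h0 (isOpen_Ioo.inter hcl.isOpen_compl) hx.1
    (⟨⟨hxc, hxd⟩, hxf⟩ : x ∈ Set.Ioo c d ∩ (f '' K)ᶜ)
  have hadd : Measure.hausdorffMeasure s (f '' K) +
      Measure.hausdorffMeasure s (K ∩ (Set.Ioo c d ∩ (f '' K)ᶜ)) ≤
      Measure.hausdorffMeasure s (f '' K) := by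
    rw [← measure_union' (Set.disjoint_left.2 fun y hy hy' => hy'.2.2 hy) hcl.measurableSet]
    refine (measure_mono (Set.union_subset hsub ?_)).trans hle
    exact fun y hy => ⟨hy.1, hy.2.1.1.le, hy.2.1.2.le⟩
  have hfin : Measure.hausdorffMeasure s (f '' K) ≠ ⊤ := measure_ne_top_of_subset hfK htop
  exact absurd hadd (ENNReal.lt_add_right hfin hpos.ne').not_ge

/-! ### Gaps and their transport by similarities -/

/-- The points `a < b` are the endpoints of a bounded complementary interval of `K`. -/
def IsGap (K : Set ℝ) (a b : ℝ) : Prop :=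
  a ∈ K ∧ b ∈ K ∧ a < b ∧ ∀ z ∈ K, z ≤ a ∨ b ≤ z

namespace IsGap

variable {K : Set ℝ} {a b : ℝ}

theorem right_unique {b' : ℝ} (h : IsGap K a b) (h' : IsGap K a b') : b = b' :=
  le_antisymm ((h.2.2.2 b' h'.2.1).resolve_left h'.2.2.1.not_ge)
    ((h'.2.2.2 b h.2.1).resolve_left h.2.2.1.not_ge)

theorem finite_setOf_lt (hK : Bornology.IsBounded K) {ε : ℝ} (hε : 0 < ε) :
    {p : ℝ × ℝ | IsGap K p.1 p.2 ∧ ε < p.2 - p.1}.Finite := by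
  obtain ⟨m, hm⟩ := hK.bddBelow
  obtain ⟨M, hM⟩ := hK.bddAbove
  refine Set.Finite.of_finite_image (f := fun p => ⌊p.1 / ε⌋)
    ((Set.finite_Icc ⌊m / ε⌋ ⌊M / ε⌋).subset ?_) ?_
  · rintro _ ⟨p, ⟨hp, -⟩, rfl⟩
    exact ⟨Int.floor_mono (div_le_div_of_nonneg_right (hm hp.1) hε.le),
      Int.floor_mono (div_le_div_of_nonneg_right (hM hp.1) hε.le)⟩
  -- A later gap starts no earlier than the previous one ends, so left endpoints of long gaps are
  -- more than `ε` apart.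
  · have key : ∀ p q : ℝ × ℝ, IsGap K p.1 p.2 → ε < p.2 - p.1 → IsGap K q.1 q.2 →
        p.1 < q.1 → ⌊p.1 / ε⌋ ≠ ⌊q.1 / ε⌋ := by
      intro p q hp hlt hq hpq heq
      have h1 := (hp.2.2.2 q.1 hq.1).resolve_left hpq.not_ge
      have h2 : p.1 / ε + 1 ≤ q.1 / ε := by
        rw [div_add_one hε.ne']
        exact div_le_div_of_nonneg_right (by linarith) hε.le
      have h3 := Int.floor_mono h2
      rw [Int.floor_add_one, ← heq] at h3
      omega
    rintro p ⟨hp, hp'⟩ q ⟨hq, hq'⟩ heq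
    have h1 : p.1 = q.1 := by
      obtain h | h | h := lt_trichotomy p.1 q.1
      · exact absurd heq (key p q hp hp' hq h)
      · exact h
      · exact absurd heq.symm (key q p hq hq' hp h)
    refine Prod.ext h1 ?_
    rw [← h1] at hq
    exact hp.right_unique hq

theorem not_chain {t : ℝ} (h : IsGap K a b) (ht : t < b - a) :
    ¬ chainSetoid K t ⟨a, h.1⟩ ⟨b, h.2.1⟩ := by
  have key : ∀ z : K, chainSetoid K t ⟨a, h.1⟩ z → (z : ℝ) ≤ a := by
    intro z hz
    change Relation.ReflTransGen _ _ z at hz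
    induction hz with
    | refl => exact le_rfl
    | @tail u v _ huv ih =>
      refine (h.2.2.2 v v.2).resolve_right fun hbv => ?_
      rw [Subtype.dist_eq, Real.dist_eq] at huv
      have := (neg_le_abs _).trans huv
      linarith
  exact fun hc => (key _ hc).not_gt h.2.2.1

theorem image {f : ℝ → ℝ} {r : ℝ} (h : IsGap K a b) (hf : ScalesDist f r) (hr : 0 < r)
    (hfK : f '' K ⊆ K) (hord : ∀ x ∈ K, ∀ u ∈ f '' K, ∀ v ∈ f '' K, u ≤ x → x ≤ v → x ∈ f '' K) :
    ∃ a' b', IsGap K a' b' ∧ b' - a' = r * (b - a) := by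
  have hfa := Set.mem_image_of_mem f h.1
  have hfb := Set.mem_image_of_mem f h.2.1
  have hmin : min (f a) (f b) ∈ f '' K := by
    obtain h | h := min_choice (f a) (f b) <;> rw [h] <;> assumption
  have hmax : max (f a) (f b) ∈ f '' K := by
    obtain h | h := max_choice (f a) (f b) <;> rw [h] <;> assumption
  have hab := h.2.2.1
  have hlen : max (f a) (f b) - min (f a) (f b) = r * (b - a) := by
    rw [max_sub_min_eq_abs, abs_sub_comm, ← Real.dist_eq, hf, dist_comm, Real.dist_eq,
      abs_of_pos (sub_pos.2 hab)]
  refine ⟨min (f a) (f b), max (f a) (f b), ⟨hfK hmin, hfK hmax, ?_, fun z hz => ?_⟩, hlen⟩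
  · have := mul_pos hr (sub_pos.2 hab)
    linarith
  · by_contra! hcon
    obtain ⟨w, hw, rfl⟩ := hord z hz _ hmin _ hmax hcon.1.le hcon.2.le
    -- Betweenness as equality in the triangle inequality passes through `f` whether or not `f`
    -- reverses orientation.
    have hsum : dist (f a) (f w) + dist (f w) (f b) = dist (f a) (f b) := by
      rw [dist_add_dist_eq_iff, ← mem_segment_iff_wbtw, segment_eq_uIcc]
      exact ⟨hcon.1.le, hcon.2.le⟩
    rw [hf, hf, hf, ← mul_add, mul_right_inj' hr.ne', dist_add_dist_eq_iff,
      ← mem_segment_iff_wbtw, segment_eq_Icc hab.le] at hsum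
    obtain h1 | h1 := h.2.2.2 w hw
    · obtain rfl := le_antisymm h1 hsum.1
      rcases le_total (f w) (f b) with h2 | h2
      · simp [h2] at hcon
      · simp [h2] at hcon
    · obtain rfl := le_antisymm h1 hsum.2
      rcases le_total (f a) (f b) with h2 | h2
      · simp [h2] at hcon
      · simp [h2] at hcon

/-- Order-convexity is not needed here: a point of `K` between `x` and `y` would map to a point of
`K` inside the gap. -/
theorem preimage {f : ℝ → ℝ} {r x y : ℝ} (h : IsGap K (f x) (f y)) (hf : ScalesDist f r)
    (hr : 0 < r) (hfK : f '' K ⊆ K) (hx : x ∈ K) (hy : y ∈ K) :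
    ∃ a' b', IsGap K a' b' ∧ f y - f x = r * (b' - a') := by
  have hinj := hf.injective hr
  have hxy : x ≠ y := fun hxy => h.2.2.1.ne (congrArg f hxy)
  refine ⟨min x y, max x y, ⟨?_, ?_, min_lt_max.2 hxy, fun z hz => ?_⟩, ?_⟩
  · obtain h | h := min_choice x y <;> rw [h] <;> assumption
  · obtain h | h := max_choice x y <;> rw [h] <;> assumption
  · by_contra! hcon
    have hsum : dist x z + dist z y = dist x y := by
      rw [dist_add_dist_eq_iff, ← mem_segment_iff_wbtw, segment_eq_uIcc]
      exact ⟨hcon.1.le, hcon.2.le⟩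
    rw [← mul_right_inj' hr.ne', mul_add, ← hf, ← hf, ← hf, dist_add_dist_eq_iff,
      ← mem_segment_iff_wbtw, segment_eq_Icc h.2.2.1.le] at hsum
    obtain h1 | h1 := h.2.2.2 (f z) (hfK ⟨z, hz, rfl⟩)
    · obtain rfl := hinj (le_antisymm h1 hsum.1)
      rcases le_total z y with h2 | h2
      · simp [h2] at hcon
      · simp [h2] at hcon
    · obtain rfl := hinj (le_antisymm h1 hsum.2)
      rcases le_total x y with h2 | h2
      · simp [h2] at hcon
      · simp [h2] at hcon
  · rw [max_sub_min_eq_abs, abs_sub_comm, ← Real.dist_eq, ← hf, dist_comm, Real.dist_eq,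
      abs_of_pos (sub_pos.2 h.2.2.1)]

end IsGap

/-! ### Chains, gaps and the gap length set -/

theorem exists_isGap_of_not_chain {K : Set ℝ} (hK : IsCompact K) {t : ℝ} (ht : 0 < t) {x y : K}
    (hxy : (x : ℝ) ≤ y) (h : ¬ chainSetoid K t x y) :
    ∃ a b, IsGap K a b ∧ (x : ℝ) ≤ a ∧ b ≤ y ∧ t < b - a := by
  set A : Set ℝ := {z | z ≤ y ∧ ∃ hz : z ∈ K, chainSetoid K t x ⟨z, hz⟩}
  have hxA : (x : ℝ) ∈ A := ⟨hxy, x.2, Relation.ReflTransGen.refl⟩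
  have hbdd : BddAbove A := ⟨y, fun z hz => hz.1⟩
  set s := sSup A
  have hsK : s ∈ K := hK.isClosed.closure_subset
    (closure_mono (fun z hz => hz.2.1) (csSup_mem_closure ⟨_, hxA⟩ hbdd))
  have hxs : (x : ℝ) ≤ s := le_csSup hbdd hxA
  have hsy : s ≤ y := csSup_le ⟨_, hxA⟩ fun z hz => hz.1
  have hR : chainSetoid K t x ⟨s, hsK⟩ := by
    obtain ⟨z, hzA, hz⟩ := exists_lt_of_lt_csSup ⟨_, hxA⟩ (sub_lt_self s ht)
    have hzs : z ≤ s := le_csSup hbdd hzA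
    refine Relation.ReflTransGen.tail hzA.2.2 ?_
    rw [Subtype.dist_eq, Real.dist_eq, abs_sub_comm, abs_of_nonneg (sub_nonneg.2 hzs)]
    linarith
  have hsy' : s < y := by
    refine hsy.lt_of_ne fun hsy => h ?_
    have : (⟨s, hsK⟩ : K) = y := Subtype.ext hsy
    rwa [this] at hR
  have hjump : ∀ z ∈ K, s < z → z ≤ y → s + t < z := by
    intro z hz hsz hzy
    by_contra! hle
    refine hsz.not_ge (le_csSup hbdd ⟨hzy, hz, Relation.ReflTransGen.tail hR ?_⟩)
    rw [Subtype.dist_eq, Real.dist_eq, abs_sub_comm, abs_of_pos (sub_pos.2 hsz)]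
    linarith
  -- No point of `K` lies in `(s, s + t]` up to `y`, so the next point can be sought in the closed
  -- interval `[s + t, y]`.
  obtain ⟨b, hb, hbmin⟩ := (hK.inter_right (isClosed_Icc (a := s + t) (b := (y : ℝ)))).exists_isLeast
    ⟨y, y.2, (hjump y y.2 hsy' le_rfl).le, le_rfl⟩
  have hsb : s < b := by linarith [hb.2.1]
  refine ⟨s, b, ⟨hsK, hb.1, hsb, fun z hz => ?_⟩, hxs, hb.2.2, ?_⟩
  · by_contra! hcon
    have hzy : z ≤ y := hcon.2.le.trans hb.2.2
    exact hcon.2.not_ge (hbmin ⟨hz, (hjump z hz hcon.1 hzy).le, hzy⟩)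
  · linarith [hjump b hb.1 hsb hb.2.2]

theorem chainSetoid_mono {K : Set ℝ} {t t' : ℝ} (htt : t ≤ t') {x y : K}
    (h : chainSetoid K t x y) : chainSetoid K t' x y :=
  Relation.ReflTransGen.mono
    (show (fun x y : K => dist x y ≤ t) ≤ fun x y => dist x y ≤ t' from
      fun _ _ hd => le_trans hd htt) _ _ h

/-- A gap separating points at distance at most `t'` at scale `t` would be longer than `t`, hence
longer than `t'`, and not fit between them. -/
theorem chainSetoid_eq {K : Set ℝ} (hK : IsCompact K) {t t' : ℝ} (ht : 0 < t) (htt : t ≤ t')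
    (hgap : ∀ a b, IsGap K a b → t < b - a → t' < b - a) :
    chainSetoid K t = chainSetoid K t' := by
  have key : ∀ x y : K, (x : ℝ) ≤ y → dist x y ≤ t' → chainSetoid K t x y := by
    intro x y hxy hd
    by_contra hcon
    obtain ⟨a, b, hab, hxa, hby, hlt⟩ := exists_isGap_of_not_chain hK ht hxy hcon
    have h1 := hgap a b hab hlt
    rw [Subtype.dist_eq, Real.dist_eq, abs_sub_comm, abs_of_nonneg (sub_nonneg.2 hxy)] at hd
    linarith
  refine Setoid.ext fun x y => ⟨chainSetoid_mono htt, fun h => ?_⟩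
  change Relation.ReflTransGen _ x y at h
  induction h with
  | refl => exact Relation.ReflTransGen.refl
  | @tail u v _ huv ih =>
    refine (chainSetoid K t).trans' ih ?_
    rcases le_total (u : ℝ) v with h | h
    · exact key u v h huv
    · exact (chainSetoid K t).symm' (key v u h (by rwa [dist_comm]))

theorem finite_quotient_chainSetoid {K : Set ℝ} (hK : IsCompact K) {t : ℝ} (ht : 0 < t) :
    Finite (Quotient (chainSetoid K t)) := by
  obtain ⟨C, hC, hfin, hcover⟩ := hK.finite_cover_balls ht
  have := hfin.to_subtype
  refine Finite.of_surjective
    (fun c : C => (Quotient.mk (chainSetoid K t) ⟨c, hC c.2⟩)) fun q => ?_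
  obtain ⟨x, rfl⟩ := Quotient.exists_rep q
  obtain ⟨c, hc, hx⟩ := Set.mem_iUnion₂.1 (hcover x.2)
  refine ⟨⟨c, hc⟩, Quotient.sound (Relation.ReflTransGen.single ?_)⟩
  rw [Subtype.dist_eq, dist_comm]
  exact (Metric.mem_ball.1 hx).le

theorem IsGap.chainClassCount_lt {K : Set ℝ} (hK : IsCompact K) {a b t : ℝ} (h : IsGap K a b)
    (ht : 0 < t) (hlt : t < b - a) : chainClassCount K (b - a) < chainClassCount K t := by
  by_contra! hle
  have := finite_quotient_chainSetoid hK ht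
  let g : Quotient (chainSetoid K t) → Quotient (chainSetoid K (b - a)) :=
    Quotient.map id fun x y hxy => chainSetoid_mono hlt.le hxy
  have hg : Function.Surjective g := by
    intro q
    obtain ⟨x, rfl⟩ := Quotient.exists_rep q
    exact ⟨Quotient.mk _ x, rfl⟩
  have hinj := (hg.bijective_of_nat_card_le hle).1
  refine h.not_chain hlt (Quotient.exact (hinj (Quotient.sound ?_)))
  refine Relation.ReflTransGen.single ?_
  rw [Subtype.dist_eq, dist_comm, Real.dist_eq]
  exact (abs_of_pos (sub_pos.2 h.2.2.1)).le

/-- Only finitely many gaps exceed `δ / 2`, so the count is locally constant off gap lengths; at a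
gap length it drops by at least one. -/
theorem mem_gapLengthSet_iff {K : Set ℝ} (hK : IsCompact K) {δ : ℝ} :
    δ ∈ gapLengthSet K ↔ δ < Metric.diam K ∧ ∃ a b, IsGap K a b ∧ b - a = δ := by
  constructor
  · rintro ⟨⟨hδ0, hδ1⟩, hdisc⟩
    refine ⟨hδ1, ?_⟩
    by_contra! hno
    refine hdisc (ContinuousAt.continuousWithinAt ?_)
    have hfin := (IsGap.finite_setOf_lt hK.isBounded (half_pos hδ0)).image
      (fun p : ℝ × ℝ => p.2 - p.1)
    have hnhds : ((fun p : ℝ × ℝ => p.2 - p.1) ''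
        {p : ℝ × ℝ | IsGap K p.1 p.2 ∧ δ / 2 < p.2 - p.1})ᶜ ∈ 𝓝 δ := by
      refine hfin.isClosed.isOpen_compl.mem_nhds ?_
      rintro ⟨p, ⟨hp, -⟩, hpδ⟩
      exact hno _ _ hp hpδ
    obtain ⟨ε, hε, hball⟩ := Metric.mem_nhds_iff.1 hnhds
    have hfar : ∀ a b, IsGap K a b → δ / 2 < b - a → ε ≤ |b - a - δ| := by
      intro a b hab hlt
      by_contra! hcon
      exact hball (Metric.mem_ball.2 hcon) ⟨(a, b), ⟨hab, hlt⟩, rfl⟩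
    have hev : (fun t : ℝ => (chainClassCount K t : ℝ)) =ᶠ[𝓝 δ]
        fun _ => (chainClassCount K δ : ℝ) := by
      filter_upwards [Metric.ball_mem_nhds δ (lt_min hε (half_pos hδ0))] with t ht
      rw [Metric.mem_ball, Real.dist_eq, lt_min_iff, abs_lt, abs_lt] at ht
      have heq : chainSetoid K t = chainSetoid K δ := by
        rcases le_total t δ with htδ | htδ
        · refine chainSetoid_eq hK (by linarith) htδ fun a b hab hlt => ?_
          have h1 := hfar a b hab (by linarith)
          rw [le_abs] at h1
          rcases h1 with h1 | h1 <;> linarith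
        · refine (chainSetoid_eq hK hδ0 htδ fun a b hab hlt => ?_).symm
          have h1 := hfar a b hab (by linarith)
          rw [le_abs] at h1
          rcases h1 with h1 | h1 <;> linarith
      rw [chainClassCount, chainClassCount, heq]
    exact continuousAt_const.congr hev.symm
  · rintro ⟨hδ, a, b, hab, rfl⟩
    have hpos : 0 < b - a := sub_pos.2 hab.2.2.1
    refine ⟨⟨hpos, hδ⟩, fun hcont => ?_⟩
    obtain ⟨ε, hε, hclose⟩ := Metric.continuousWithinAt_iff.1 hcont 1 one_pos
    set t := max ((b - a) / 2) (b - a - ε / 2)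
    have ht0 : 0 < t := lt_max_of_lt_left (half_pos hpos)
    have ht1 : t < b - a := max_lt (half_lt_self hpos) (by linarith)
    have ht2 : b - a - ε / 2 ≤ t := le_max_right _ _
    have h1 := hclose (x := t) ⟨ht0, ht1.trans hδ⟩
      (by rw [Real.dist_eq, abs_lt]; constructor <;> linarith)
    have h2 := hab.chainClassCount_lt hK ht0 ht1
    have h3 : (chainClassCount K (b - a) : ℝ) + 1 ≤ chainClassCount K t := by exact_mod_cast h2
    rw [Real.dist_eq, abs_lt] at h1
    linarith

/-- A compact set without gaps is an interval. -/
theorem exists_isGap_of_not_ordConnected {K : Set ℝ} (hK : IsCompact K) (h : ¬ K.OrdConnected) :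
    ∃ a b, IsGap K a b := by
  rw [Set.ordConnected_def] at h
  push Not at h
  obtain ⟨x, hx, y, hy, hxy⟩ := h
  obtain ⟨z, hz, hzK⟩ := Set.not_subset.1 hxy
  obtain ⟨a, ha, hamax⟩ := (hK.inter_right isClosed_Iic).exists_isGreatest ⟨x, hx, hz.1⟩
  obtain ⟨b, hb, hbmin⟩ := (hK.inter_right isClosed_Ici).exists_isLeast ⟨y, hy, hz.2⟩
  have haz : a < z := lt_of_le_of_ne ha.2 fun h => hzK (h ▸ ha.1)
  have hzb : z < b := lt_of_le_of_ne hb.2 fun h => hzK (h ▸ hb.1)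
  refine ⟨a, b, ha.1, hb.1, haz.trans hzb, fun w hw => ?_⟩
  rcases le_total w z with hwz | hwz
  · exact Or.inl (hamax ⟨hw, hwz⟩)
  · exact Or.inr (hbmin ⟨hw, hwz⟩)

/-- Order-convexity of similar copies of a strongly separated full-measure set inside the set. -/
theorem IsFullMeasure.mem_image_of_between {K : Set ℝ} (hK : IsFullMeasure K)
    {Φ : SimilarityIFS ℝ} (hΦ : Φ.Generates K) (hsep : Φ.StrongSeparation K)
    {f : ℝ → ℝ} {r : ℝ} (hf : ScalesDist f r) (hr : 0 < r) (hfK : f '' K ⊆ K) :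
    ∀ x ∈ K, ∀ u ∈ f '' K, ∀ v ∈ f '' K, u ≤ x → x ≤ v → x ∈ f '' K := by
  intro x hx u hu v hv hux hxv
  have hcpt := hK.2.1.image (hf.continuous hr)
  obtain ⟨c, hc⟩ := hcpt.exists_isLeast (hK.1.image f)
  obtain ⟨d, hd⟩ := hcpt.exists_isGreatest (hK.1.image f)
  exact hK.inter_Icc_subset_image hΦ hsep hf hr hfK hc hd
    ⟨hx, (hc.2 hu).trans hux, hxv.trans (hd.2 hv)⟩

/-! ### Gap lengths under an arbitrary generating IFS -/

namespace SimilarityIFS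

variable {Ψ : SimilarityIFS ℝ} {K : Set ℝ}

/-- Up to finitely many lengths, every gap of the attractor is a scaled copy of a gap. -/
theorem Generates.exists_finite_gap_lengths (h : Ψ.Generates K)
    (hord : ∀ j, ∀ x ∈ K, ∀ u ∈ Ψ.map j '' K, ∀ v ∈ Ψ.map j '' K, u ≤ x → x ≤ v →
      x ∈ Ψ.map j '' K) :
    ∃ F : Set ℝ, F.Finite ∧ ∀ a b, IsGap K a b →
      b - a ∈ F ∨ ∃ j a' b', IsGap K a' b' ∧ b - a = Ψ.ratio j * (b' - a') := by
  -- The exceptional gaps start at the maximum of a copy, so each index gives at most one.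
  refine ⟨⋃ j, {δ | ∃ a b, IsGap K a b ∧ IsGreatest (Ψ.map j '' K) a ∧ b - a = δ},
    Set.finite_iUnion fun j => Set.Subsingleton.finite ?_, fun a b hab => ?_⟩
  · rintro _ ⟨a, b, hab, ha, rfl⟩ _ ⟨a', b', hab', ha', rfl⟩
    obtain rfl := ha.unique ha'
    rw [hab.right_unique hab']
  · obtain ⟨j, hj⟩ := h.exists_mem_image hab.1
    by_cases hmax : IsGreatest (Ψ.map j '' K) a
    · exact Or.inl (Set.mem_iUnion.2 ⟨j, a, b, hab, hmax, rfl⟩)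
    · right
      have hex : ∃ v ∈ Ψ.map j '' K, a < v := by
        by_contra! hcon
        exact hmax ⟨hj, hcon⟩
      obtain ⟨v, hv, hav⟩ := hex
      have hbv := (hab.2.2.2 v (h.image_subset j hv)).resolve_left hav.not_ge
      obtain ⟨y, hy, rfl⟩ := hord j b hab.2.1 a hj v hv hab.2.2.1.le hbv
      obtain ⟨x, hx, rfl⟩ := hj
      obtain ⟨a', b', hab', hlen⟩ := hab.preimage (Ψ.scalesDist j) (Ψ.ratio_pos j)
        (h.image_subset j) hx hy
      exact ⟨j, a', b', hab', hlen⟩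

theorem Generates.exists_finite_log_gap (h : Ψ.Generates K)
    (hord : ∀ j, ∀ x ∈ K, ∀ u ∈ Ψ.map j '' K, ∀ v ∈ Ψ.map j '' K, u ≤ x → x ≤ v →
      x ∈ Ψ.map j '' K) :
    ∃ F : Set ℝ, F.Finite ∧ ∀ a b, IsGap K a b → ∃ φ ∈ F, Real.log (b - a) - Real.log φ ∈
      Submodule.span ℚ (Set.range fun j => Real.log (Ψ.ratio j)) := by
  obtain ⟨F, hF, hdecomp⟩ := h.exists_finite_gap_lengths hord
  refine ⟨F, hF, fun a b hab => ?_⟩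
  obtain ⟨ρ, hρ0, hρ1, hρ⟩ := Ψ.exists_ratio_le
  have hlim : Filter.Tendsto (fun n : ℕ => ρ ^ n * Metric.diam K) Filter.atTop (𝓝 0) := by
    simpa using (tendsto_pow_atTop_nhds_zero_of_lt_one hρ0.le hρ1).mul_const (Metric.diam K)
  -- Undoing a map lengthens the gap by a factor at least `ρ⁻¹`, and gaps are at most `diam K` long,
  -- so `n` bounds the descent.
  obtain ⟨n, hn⟩ := (hlim.eventually (gt_mem_nhds (sub_pos.2 hab.2.2.1))).exists
  induction n generalizing a b with
  | zero =>
    have h1 := Metric.dist_le_diam_of_mem h.2.1.isBounded hab.2.1 hab.1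
    rw [Real.dist_eq, abs_of_pos (sub_pos.2 hab.2.2.1)] at h1
    linarith
  | succ n ih =>
    obtain hmem | ⟨j, a', b', hab', hlen⟩ := hdecomp a b hab
    · exact ⟨b - a, hmem, by simp⟩
    · have hpos : 0 < b' - a' := sub_pos.2 hab'.2.2.1
      have hn' : ρ ^ n * Metric.diam K < b' - a' := by
        rw [hlen, pow_succ', mul_assoc] at hn
        exact lt_of_mul_lt_mul_left
          (hn.trans_le (mul_le_mul_of_nonneg_right (hρ j) hpos.le)) hρ0.le
      obtain ⟨φ, hφ, hspan⟩ := ih a' b' hab' hn'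
      refine ⟨φ, hφ, ?_⟩
      rw [hlen, Real.log_mul (Ψ.ratio_pos j).ne' hpos.ne', add_sub_assoc]
      exact add_mem (Submodule.subset_span ⟨j, rfl⟩) hspan

theorem Generates.gapLogSpan_le (h : Ψ.Generates K)
    (hord : ∀ j, ∀ x ∈ K, ∀ u ∈ Ψ.map j '' K, ∀ v ∈ Ψ.map j '' K, u ≤ x → x ≤ v →
      x ∈ Ψ.map j '' K) :
    gapLogSpan K ≤ Submodule.span ℚ (Set.range fun j => Real.log (Ψ.ratio j)) := by
  refine Submodule.span_le.2 ?_
  rintro _ ⟨r, hr, rfl⟩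
  obtain ⟨θ, -, ⟨hr0, hr1⟩, θ', hθ', -, hgeom⟩ := Set.mem_iUnion₂.1 hr
  obtain ⟨F, hF, hlog⟩ := h.exists_finite_log_gap hord
  have := hF.to_subtype
  have hstep : ∀ k : ℕ, ∃ φ : F, Real.log (θ' * r ^ k) - Real.log φ ∈
      Submodule.span ℚ (Set.range fun j => Real.log (Ψ.ratio j)) := by
    intro k
    obtain ⟨-, a, b, hab, hk⟩ := (mem_gapLengthSet_iff h.2.1).1 (hgeom k)
    obtain ⟨φ, hφ, hspan⟩ := hlog a b hab
    exact ⟨⟨φ, hφ⟩, hk ▸ hspan⟩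
  choose φ hφ using hstep
  -- Pigeonhole: two exponents share the same `φ`, and subtracting leaves `(k - l) * log r` in the
  -- span.
  obtain ⟨k, l, hkl, heq⟩ := Finite.exists_ne_map_eq_of_infinite φ
  have hdiff := sub_mem (hφ k) (hφ l)
  have hθ0 : θ' ≠ 0 := hθ'.1.1.ne'
  rw [heq, sub_sub_sub_cancel_right, Real.log_mul hθ0 (pow_ne_zero _ hr0.ne'),
    Real.log_mul hθ0 (pow_ne_zero _ hr0.ne'), add_sub_add_left_eq_sub, Real.log_pow,
    Real.log_pow, ← sub_mul] at hdiff
  have hc : (k : ℚ) - l ≠ 0 := sub_ne_zero.2 (by exact_mod_cast hkl)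
  have hsmul : ((k : ℝ) - l) * Real.log r = ((k : ℚ) - l) • Real.log r := by
    rw [Rat.smul_def]
    push_cast
    rfl
  rw [hsmul] at hdiff
  exact (Submodule.smul_mem_iff _ hc).1 hdiff

end SimilarityIFS

/-! ### The cardinality bounds -/

theorem corollary3p4 (K : Set ℝ) (hK : IsFullMeasure K)
    (Φ : SimilarityIFS ℝ) (hΦ : Φ.Generates K) (hSSC : Φ.StrongSeparation K) :
    (∀ Ψ : SimilarityIFS ℝ, Ψ.Generates K →
      Module.rank ℚ (gapLogSpan K) ≤ (Ψ.card : Cardinal)) ∧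
    (LinearIndependent ℚ (fun i : Fin Φ.card => Real.log (Φ.ratio i)) →
      ∀ Ψ : SimilarityIFS ℝ, Ψ.Generates K → Φ.card ≤ Ψ.card) := by
  have hord : ∀ Ψ : SimilarityIFS ℝ, Ψ.Generates K → ∀ j, ∀ x ∈ K, ∀ u ∈ Ψ.map j '' K,
      ∀ v ∈ Ψ.map j '' K, u ≤ x → x ≤ v → x ∈ Ψ.map j '' K := fun Ψ hΨ j =>
    hK.mem_image_of_between hΦ hSSC (Ψ.scalesDist j) (Ψ.ratio_pos j) (hΨ.image_subset j)
  have hrank : ∀ Ψ : SimilarityIFS ℝ, Ψ.Generates K →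
      Module.rank ℚ (gapLogSpan K) ≤ (Ψ.card : Cardinal) := by
    intro Ψ hΨ
    refine (Submodule.rank_mono (hΨ.gapLogSpan_le (hord Ψ hΨ))).trans ((rank_span_le _).trans ?_)
    simpa using Cardinal.mk_range_le (f := fun j => Real.log (Ψ.ratio j))
  refine ⟨hrank, fun hli Ψ hΨ => ?_⟩
  obtain hcard | hcard := le_or_gt Φ.card 1
  · obtain ⟨x, hx⟩ := hK.1
    obtain ⟨j, -⟩ := hΨ.exists_mem_image hx
    exact hcard.trans j.pos
  let i₀ : Fin Φ.card := ⟨0, by omega⟩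
  let i₁ : Fin Φ.card := ⟨1, hcard⟩
  -- With at least two maps, the SSC splits `K` into two disjoint nonempty closed sets.
  have hnot : ¬ K.OrdConnected := by
    intro hconn
    have hclosed : IsClosed (⋃ i : {i : Fin Φ.card // i ≠ i₀}, Φ.map i '' K) :=
      isClosed_iUnion_of_finite fun i => (hΦ.isCompact_image i).isClosed
    obtain ⟨y, hy⟩ := hK.1
    have hcover : K ⊆ Φ.map i₀ '' K ∪ ⋃ i : {i : Fin Φ.card // i ≠ i₀}, Φ.map i '' K := by
      intro x hx
      obtain ⟨i, hi⟩ := hΦ.exists_mem_image hx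
      by_cases h0 : i = i₀
      · exact Or.inl (h0 ▸ hi)
      · exact Or.inr (Set.mem_iUnion.2 ⟨⟨i, h0⟩, hi⟩)
    obtain ⟨z, -, hz0, hz1⟩ := isPreconnected_closed_iff.1 hconn.isPreconnected _ _
      (hΦ.isCompact_image i₀).isClosed hclosed hcover
      ⟨Φ.map i₀ y, hΦ.image_subset i₀ ⟨y, hy, rfl⟩, y, hy, rfl⟩
      ⟨Φ.map i₁ y, hΦ.image_subset i₁ ⟨y, hy, rfl⟩,
        Set.mem_iUnion.2 ⟨⟨i₁, by simp [i₀, i₁]⟩, y, hy, rfl⟩⟩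
    obtain ⟨i, hi⟩ := Set.mem_iUnion.1 hz1
    exact Set.disjoint_left.1 (hSSC i₀ i i.2.symm) hz0 hi
  obtain ⟨a, b, hab⟩ := exists_isGap_of_not_ordConnected hK.2.1 hnot
  -- Scaling by a ratio below one makes the length strictly less than `diam K`, as `gapLengthSet`
  -- requires; so the geometric sequences below start at a scaled gap.
  have hscale : ∀ i a b, IsGap K a b → Φ.ratio i * (b - a) ∈ gapLengthSet K := by
    intro i a b hab
    obtain ⟨a', b', hab', hlen⟩ := hab.image (Φ.scalesDist i) (Φ.ratio_pos i)
      (hΦ.image_subset i) (hord Φ hΦ i)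
    refine (mem_gapLengthSet_iff hK.2.1).2 ⟨?_, a', b', hab', hlen⟩
    have h1 := Metric.dist_le_diam_of_mem hK.2.1.isBounded hab.2.1 hab.1
    rw [Real.dist_eq, abs_of_pos (sub_pos.2 hab.2.2.1)] at h1
    exact (mul_lt_of_lt_one_left (sub_pos.2 hab.2.2.1) (Φ.ratio_lt_one i)).trans_le h1
  have hmem : ∀ i, Real.log (Φ.ratio i) ∈ gapLogSpan K := by
    intro i
    have hθ := hscale i a b hab
    refine Submodule.subset_span ⟨Φ.ratio i, Set.mem_iUnion₂.2 ⟨_, hθ,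
      ⟨Φ.ratio_pos i, Φ.ratio_lt_one i⟩, _, hθ, ⟨0, by simp⟩, fun k => ?_⟩, rfl⟩
    induction k with
    | zero => simpa using hθ
    | succ k ih =>
      obtain ⟨-, a', b', hab', hlen⟩ := (mem_gapLengthSet_iff hK.2.1).1 ih
      have h2 := hscale i a' b' hab'
      rwa [hlen, mul_left_comm, ← pow_succ'] at h2
  have hli' : LinearIndependent ℚ (fun i => (⟨Real.log (Φ.ratio i), hmem i⟩ : gapLogSpan K)) :=
    LinearIndependent.of_comp (gapLogSpan K).subtype hli
  have hle := hli'.cardinal_lift_le_rank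
  simp only [Cardinal.mk_fin, Cardinal.lift_id] at hle
  exact_mod_cast hle.trans (hrank Ψ hΨ)
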